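/- Let $\zeta$ be a two-qubit state, i.e. a positive semidefinite operator of trace one on $\mathbb C^2\otimes\mathbb C^2$. Let $s_1,s_2,s_3$ be the Pauli matrices and $\vec s=(s_1,s_2,s_3)$, let $T=[t_{ij}]$, $t_{ij}=\mathrm{Tr}(\zeta\, s_i\otimes s_j)$, be the correlation matrix of $\zeta$, let $u_1,u_2,u_3$ be the eigenvalues of $T^\dagger T$, and put $N(\zeta)=\mathrm{Tr}\sqrt{T^\dagger T}=\sum_{i=1}^3\sqrt{u_i}$. Let $$F_3(\zeta)=\sup_\mu F_3(\zeta,\mu),\qquad F_3(\zeta,\mu)=\frac1{\sqrt3}\Big|\sum_{i=1}^3\mathrm{Tr}\big(\zeta\,(\hat u_i\cdot\vec s)\otimes(\hat v_i\cdot\vec s)\big)\Big|,$$ where $\mu=\{\hat u_1,\hat u_2,\hat u_3,\hat v_1,\hat v_2,\hat v_3\}$ runs over all choices of unit vectors $\hat u_i\in\mathbb R^3$ and orthonormal vectors $\hat v_i\in\mathbb R^3$. The state $\zeta$ is called 3-steerable if $F_3(\zeta)>1$. In the standard teleportation scheme a pure qubit state $P$ is teleported with the help of $\zeta$: Alice measures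 the input qubit and her half (the first qubit) of $\zeta$ in the Bell basis, and, upon outcome $k$ (with probability $p_k$), Bob applies a unitary $W_k$ to the second qubit, which leaves him with a state $\rho_k$. The state $\zeta$ is called useful for teleportation if for some choice of unitaries $W_1,\dots,W_4$ the fidelity $\sum_k p_k\mathrm{Tr}(\rho_kP)$, averaged over inputs $P$ uniformly distributed on the Bloch sphere, exceeds the classical value $2/3$. Then the supremum defining $F_3(\zeta)$ is attained, and $$F_3(\zeta)=\sqrt{u_1+u_2+u_3}\le \sqrt{u_1}+\sqrt{u_2}+\sqrt{u_3}=N(\zeta).$$ Moreover, if $\zeta$ is 3-steerable, then $\zeta$ is useful for teleportation. -/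

import Mathlib

open scoped Matrix Kronecker ComplexOrder

noncomputable section

namespace TwoQubit

/-- Operators on one qubit, in the computational basis. -/
abbrev Op1 : Type := Matrix (Fin 2) (Fin 2) ℂ

/-- Operators on two qubits, in the computational product basis. -/
abbrev Op2 : Type := Matrix (Fin 2 × Fin 2) (Fin 2 × Fin 2) ℂ

/-- Density matrices of two qubits: positive semidefinite of trace one. -/
def IsDensityMatrix (ρ : Op2) : Prop := ρ.PosSemidef ∧ ρ.trace = 1

/-- The three Pauli matrices. -/
def pauli : Fin 3 → Op1
  | 0 => !![0, 1; 1, 0]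
  | 1 => !![0, -Complex.I; Complex.I, 0]
  | 2 => !![1, 0; 0, -1]

/-- The spin observable `n · s` in the direction `n`. -/
def spin (n : EuclideanSpace ℝ (Fin 3)) : Op1 := ∑ i, (n i : ℂ) • pauli i

/-- The expectation value `⟨A ⊗ B⟩ = Tr(ρ (A ⊗ B))`. -/
def expect (ρ : Op2) (A B : Op1) : ℂ := (ρ * (A ⊗ₖ B)).trace

/-! ### Three-setting steering -/

/-- A choice of measurement directions: three unit vectors `u i` for the first party and three
orthonormal vectors `v i` for the second one. -/
structure MeasurementDirections where
  u : Fin 3 → EuclideanSpace ℝ (Fin 3)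
  v : Fin 3 → EuclideanSpace ℝ (Fin 3)
  norm_u : ∀ i, ‖u i‖ = 1
  orthonormal_v : Orthonormal ℝ v

/-- The steering parameter `F₃(ρ, μ) = (1/√3) |∑ i, ⟨A i ⊗ B i⟩|`; the steering inequality for `μ`
reads `F₃(ρ, μ) ≤ 1`. -/
def steeringParameter (ρ : Op2) (μ : MeasurementDirections) : ℝ :=
  1 / √3 * ‖∑ i, expect ρ (spin (μ.u i)) (spin (μ.v i))‖

/-- `F₃(ρ)`: the optimal value of the steering parameter over all measurement directions. -/
def F3 (ρ : Op2) : ℝ := sSup (Set.range (steeringParameter ρ))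

/-- A state is 3-steerable if `F₃(ρ) > 1`. -/
def IsThreeSteerable (ρ : Op2) : Prop := 1 < F3 ρ

/-! ### The correlation matrix -/

/-- The correlation matrix `T = [t i j]` of the Hilbert–Schmidt expansion
`ρ = (1/4) (I ⊗ I + a·s ⊗ I + I ⊗ b·s + ∑ i j, t i j • s i ⊗ s j)`, that is,
`t i j = Tr(ρ (s i ⊗ s j))` (a real number for Hermitian `ρ`). -/
def correlationMatrix (ρ : Op2) : Matrix (Fin 3) (Fin 3) ℝ :=
  fun i j => (expect ρ (pauli i) (pauli j)).re

/-- The eigenvalues `u₁, u₂, u₃` of `T† T`, with multiplicity. -/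
def corrEigenvalues (ρ : Op2) : Fin 3 → ℝ :=
  (Matrix.isHermitian_conjTranspose_mul_self (correlationMatrix ρ)).eigenvalues

/-- `N(ρ) = Tr √(T† T) = ∑ i, √(u i)`. -/
def N (ρ : Op2) : ℝ := ∑ i, √(corrEigenvalues ρ i)

/-! ### The standard teleportation scheme -/

/-- The Bell basis `Φ⁺, Φ⁻, Ψ⁺, Ψ⁻` of two qubits. -/
def bell (k : Fin 4) : Fin 2 × Fin 2 → ℂ := fun p =>
  ((1 / √2 : ℝ) : ℂ) *
    (![!![1, 0; 0, 1], !![1, 0; 0, -1], !![0, 1; 1, 0], !![0, 1; -1, 0]] k : Op1) p.1 p.2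

/-- The projector onto the `k`-th Bell vector. -/
def bellProj (k : Fin 4) : Op2 := Matrix.vecMulVec (bell k) (star (bell k))

/-- The projector onto the pure qubit state `cos(θ/2) |0⟩ + exp(iφ) sin(θ/2) |1⟩`, whose Bloch
vector has polar angle `θ` and azimuth `φ`. -/
def inputState (θ φ : ℝ) : Op1 :=
  let ψ : Fin 2 → ℂ := ![(Real.cos (θ / 2) : ℂ), Complex.exp (φ * Complex.I) * Real.sin (θ / 2)]
  Matrix.vecMulVec ψ (star ψ)

/-- Partial trace over the first tensor factor. -/
def traceFst (M : Matrix ((Fin 2 × Fin 2) × Fin 2) ((Fin 2 × Fin 2) × Fin 2) ℂ) : Op1 :=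
  fun i j => ∑ k, M (k, i) (k, j)

/-- The joint state `P ⊗ ρ` of the input qubit and the shared pair, with the input qubit and
Alice's qubit (the first of the pair) grouped together. -/
def jointState (P : Op1) (ρ : Op2) :
    Matrix ((Fin 2 × Fin 2) × Fin 2) ((Fin 2 × Fin 2) × Fin 2) ℂ :=
  (P ⊗ₖ ρ).submatrix (Equiv.prodAssoc _ _ _) (Equiv.prodAssoc _ _ _)

/-- Bob's unnormalised output `p k • ρ k` for the input `P`, when Alice's Bell measurement on the
input qubit and her half of `ρ` has outcome `k` (of probability `p k`), and Bob then applies the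
unitary `W`. -/
def bobOutput (ρ : Op2) (P : Op1) (k : Fin 4) (W : Op1) : Op1 :=
  traceFst ((bellProj k ⊗ₖ W) * jointState P ρ * (bellProj k ⊗ₖ W)ᴴ)

/-- The fidelity `∑ k, p k * Tr(ρ k P)` of the teleported state with the pure input `P`. -/
def outputFidelity (ρ : Op2) (W : Fin 4 → Matrix.unitaryGroup (Fin 2) ℂ) (P : Op1) : ℝ :=
  ∑ k, ((bobOutput ρ P k (W k : Op1)) * P).trace.re

/-- The average fidelity of the standard teleportation scheme with shared state `ρ` and corrections
`W k`, the pure input being uniformly distributed on the Bloch sphere (normalised area element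
`sin θ / (4π) dφ dθ`). -/
def avgFidelity (ρ : Op2) (W : Fin 4 → Matrix.unitaryGroup (Fin 2) ℂ) : ℝ :=
  1 / (4 * Real.pi) * ∫ θ in (0 : ℝ)..Real.pi, ∫ φ in (0 : ℝ)..(2 * Real.pi),
    outputFidelity ρ W (inputState θ φ) * Real.sin θ

/-- A state is useful for (standard) teleportation if, with suitable corrections by Bob, its average
fidelity exceeds `2/3`, the best value attainable by classical means. -/
def IsUsefulForTeleportation (ρ : Op2) : Prop :=
  ∃ W : Fin 4 → Matrix.unitaryGroup (Fin 2) ℂ, 2 / 3 < avgFidelity ρ W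

end TwoQubit

end

noncomputable section

namespace TwoQubit

/-! ### Expectation values of product observables -/

/-! For Hermitian `ρ`, the steering parameter is `|∑ ⟨u i, T (v i)⟩| / √3`. Two applications of
Cauchy–Schwarz bound it by the Hilbert–Schmidt norm of `T`, the root of the sum of the eigenvalues.
Equality needs `u i` parallel to `T (v i)` and all `‖T (v i)‖` equal;
`exists_orthonormal_norm_sq_eq` supplies such a `v`. The comparison with `N` is ℓ² ≤ ℓ¹.

For teleportation, corrections adapted to a unitary `V` give average fidelity `(1 + 2f) / 3`, with
`f` the overlap of `ρ` with `(1 ⊗ V) Φ⁺`, so `f > 1/2` suffices. With `V` a unit quaternion `q`, `f`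
is a real quadratic form in `q`, whose 4 × 4 matrix `A` is positive semidefinite with `Tr A = 1` and
`Tr A² = (1 + Tr TᵀT) / 4`. Steerability gives `Tr A² > 1/2`, and since `Tr A² ≤ λ_max Tr A`, some
`q` has `f > 1/2`. No singular value decomposition of `T` is needed. -/

theorem expect_add_left (ρ : Op2) (A A' B : Op1) :
    expect ρ (A + A') B = expect ρ A B + expect ρ A' B := by
  simp [expect, Matrix.add_kronecker, Matrix.mul_add]

theorem expect_add_right (ρ : Op2) (A B B' : Op1) :
    expect ρ A (B + B') = expect ρ A B + expect ρ A B' := by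
  simp [expect, Matrix.kronecker_add, Matrix.mul_add]

theorem expect_smul_left (ρ : Op2) (c : ℂ) (A B : Op1) :
    expect ρ (c • A) B = c * expect ρ A B := by
  simp [expect, Matrix.smul_kronecker]

theorem expect_smul_right (ρ : Op2) (c : ℂ) (A B : Op1) :
    expect ρ A (c • B) = c * expect ρ A B := by
  simp [expect, Matrix.kronecker_smul]

theorem expect_one_one (ρ : Op2) : expect ρ 1 1 = ρ.trace := by
  simp [expect]

/-! ### The teleportation channel for corrections adapted to a unitary -/

/-- The coefficient matrices of the Bell vectors. -/
def bellMatrix (k : Fin 4) : Op1 :=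
  ![!![1, 0; 0, 1], !![1, 0; 0, -1], !![0, 1; 1, 0], !![0, 1; -1, 0]] k

theorem bellProj_apply (k : Fin 4) (p q : Fin 2 × Fin 2) :
    bellProj k p q = 1 / 2 * (bellMatrix k p.1 p.2 * star (bellMatrix k q.1 q.2)) := by
  have h : ((1 / √2 : ℝ) : ℂ) * ((1 / √2 : ℝ) : ℂ) = 1 / 2 := by
    rw [← Complex.ofReal_mul, div_mul_div_comm, Real.mul_self_sqrt (by norm_num)]; norm_num
  have hb : ∀ p, bell k p = ((1 / √2 : ℝ) : ℂ) * bellMatrix k p.1 p.2 := fun _ => rfl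
  simp only [bellProj, hb, Matrix.vecMulVec_apply, Pi.star_apply, star_mul',
    Complex.star_def, Complex.conj_ofReal]
  linear_combination (bellMatrix k p.1 p.2 * (starRingEnd ℂ) (bellMatrix k q.1 q.2)) * h

/-- Heisenberg picture: the Bell projection carries the input over to Alice's half with a transpose,
and cyclicity moves `W` onto the target `P`. -/
theorem trace_bobOutput_mul (ρ : Op2) (P W : Op1) (k : Fin 4) :
    (bobOutput ρ P k W * P).trace =
      1 / 2 * expect ρ ((bellMatrix k)ᵀ * P * bellMatrix k)ᵀ (Wᴴ * P * W) := by
  simp only [bobOutput, traceFst, jointState, expect, Matrix.trace, Matrix.diag, Matrix.mul_apply,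
    Fintype.sum_prod_type, Fin.sum_univ_two, Matrix.kroneckerMap_apply, Matrix.conjTranspose_apply,
    Matrix.submatrix_apply, Equiv.prodAssoc_apply, bellProj_apply, Matrix.transpose_apply]
  fin_cases k <;> simp [bellMatrix] <;> ring

theorem conjTranspose_bellMatrix (k : Fin 4) : (bellMatrix k)ᴴ = (bellMatrix k)ᵀ := by
  ext i j
  fin_cases k <;> fin_cases i <;> fin_cases j <;> simp [bellMatrix]

theorem bellMatrix_mem_unitaryGroup (k : Fin 4) :
    bellMatrix k ∈ Matrix.unitaryGroup (Fin 2) ℂ := by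
  rw [Matrix.mem_unitaryGroup_iff, Matrix.star_eq_conjTranspose]
  ext i j
  fin_cases k <;> fin_cases i <;> fin_cases j <;>
    simp [bellMatrix, Matrix.mul_apply, Fin.sum_univ_two]

/-- Bob's corrections `B k * Vᴴ` adapted to the maximally entangled vector `(1 ⊗ V) Φ⁺`. -/
def correction (V : Matrix.unitaryGroup (Fin 2) ℂ) (k : Fin 4) : Matrix.unitaryGroup (Fin 2) ℂ :=
  ⟨bellMatrix k, bellMatrix_mem_unitaryGroup k⟩ * star V

/-- The qubit operator with Bloch vector `(x, y, z)`. -/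
def bloch (x y z : ℝ) : Op1 :=
  (1 / 2 : ℂ) • (1 + (x : ℂ) • pauli 0 + (y : ℂ) • pauli 1 + (z : ℂ) • pauli 2)

theorem transpose_bloch (x y z : ℝ) : (bloch x y z)ᵀ = bloch x (-y) z := by
  ext i j
  fin_cases i <;> fin_cases j <;> simp [bloch, pauli] <;> ring

/-- Each Bell matrix is a Pauli matrix or the identity up to phase, so it acts as a half turn or
trivially. -/
theorem bellMatrix_conj_bloch (k : Fin 4) (x y z : ℝ) :
    (bellMatrix k)ᵀ * bloch x y z * bellMatrix k =
      bloch (![x, -x, x, -x] k) (![y, -y, -y, y] k) (![z, z, -z, -z] k) := by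
  ext i j
  fin_cases k <;> fin_cases i <;> fin_cases j <;>
    simp [bellMatrix, bloch, pauli, Matrix.mul_apply, Fin.sum_univ_two] <;> ring

theorem inputState_eq_bloch (θ φ : ℝ) :
    inputState θ φ =
      bloch (Real.sin θ * Real.cos φ) (Real.sin θ * Real.sin φ) (Real.cos θ) := by
  have hs : Real.sin θ = 2 * Real.sin (θ / 2) * Real.cos (θ / 2) := by
    rw [← Real.sin_two_mul]; ring_nf
  have hc : Real.cos θ = 2 * Real.cos (θ / 2) ^ 2 - 1 := by
    rw [← Real.cos_two_mul]; ring_nf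
  have h1 := Real.sin_sq_add_cos_sq (θ / 2)
  have h2 := Real.sin_sq_add_cos_sq φ
  have he : Complex.exp (φ * Complex.I) = Real.cos φ + Real.sin φ * Complex.I := by
    rw [Complex.exp_mul_I, Complex.ofReal_cos, Complex.ofReal_sin]
  simp only [inputState, he, hs, hc]
  generalize Real.sin (θ / 2) = s at h1 ⊢
  generalize Real.cos (θ / 2) = c at h1 ⊢
  generalize Real.sin φ = s' at h2 ⊢
  generalize Real.cos φ = c' at h2 ⊢
  ext i j
  fin_cases i <;> fin_cases j <;>
    simp [bloch, pauli, Complex.ext_iff, pow_two]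
  · constructor <;> ring
  · constructor <;> ring
  · constructor
    · linear_combination h1 + s ^ 2 * h2
    · ring

/-- Summing over the four sign patterns kills the linear and the mixed terms. The minus sign at `y ^
2` comes from the transpose. -/
theorem outputFidelity_correction (ρ : Op2) (hρ : ρ.trace = 1)
    (V : Matrix.unitaryGroup (Fin 2) ℂ) (x y z : ℝ) :
    outputFidelity ρ (correction V) (bloch x y z) =
      1 / 2 * (1 + x ^ 2 * (expect ρ (pauli 0) ((V : Op1) * pauli 0 * (V : Op1)ᴴ)).re
        - y ^ 2 * (expect ρ (pauli 1) ((V : Op1) * pauli 1 * (V : Op1)ᴴ)).re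
        + z ^ 2 * (expect ρ (pauli 2) ((V : Op1) * pauli 2 * (V : Op1)ᴴ)).re) := by
  have hV : (V : Op1) * (V : Op1)ᴴ = 1 := Matrix.mem_unitaryGroup_iff.mp V.2
  have hk : ∀ k, (correction V k : Op1)ᴴ * bloch x y z * (correction V k : Op1) =
      (V : Op1) * ((bellMatrix k)ᵀ * bloch x y z * bellMatrix k) * (V : Op1)ᴴ := by
    intro k
    have : (correction V k : Op1) = bellMatrix k * (V : Op1)ᴴ := rfl
    rw [this, Matrix.conjTranspose_mul, Matrix.conjTranspose_conjTranspose,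
      conjTranspose_bellMatrix]
    simp only [Matrix.mul_assoc]
  have hb : ∀ x y z : ℝ, (V : Op1) * bloch x y z * (V : Op1)ᴴ =
      (1 / 2 : ℂ) • (1 + (x : ℂ) • ((V : Op1) * pauli 0 * (V : Op1)ᴴ)
        + (y : ℂ) • ((V : Op1) * pauli 1 * (V : Op1)ᴴ)
        + (z : ℂ) • ((V : Op1) * pauli 2 * (V : Op1)ᴴ)) := by
    intro x y z
    simp only [bloch, Matrix.mul_add, Matrix.add_mul, Matrix.mul_smul, Matrix.smul_mul,
      Matrix.mul_one, hV]
  simp only [outputFidelity, trace_bobOutput_mul, hk, bellMatrix_conj_bloch, transpose_bloch, hb]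
  rw [← Complex.re_sum]
  simp only [bloch, expect_add_left, expect_add_right, expect_smul_left, expect_smul_right,
    expect_one_one, hρ, Fin.sum_univ_four]
  simp
  ring

/-- Each squared coordinate has mean `1/3` on the sphere. -/
theorem avgFidelity_correction (ρ : Op2) (hρ : ρ.trace = 1)
    (V : Matrix.unitaryGroup (Fin 2) ℂ) :
    avgFidelity ρ (correction V) =
      1 / 2 * (1 + 1 / 3 * ((expect ρ (pauli 0) ((V : Op1) * pauli 0 * (V : Op1)ᴴ)).re
        - (expect ρ (pauli 1) ((V : Op1) * pauli 1 * (V : Op1)ᴴ)).re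
        + (expect ρ (pauli 2) ((V : Op1) * pauli 2 * (V : Op1)ᴴ)).re)) := by
  simp only [avgFidelity, inputState_eq_bloch, outputFidelity_correction ρ hρ]
  generalize (expect ρ (pauli 0) ((V : Op1) * pauli 0 * (V : Op1)ᴴ)).re = a
  generalize (expect ρ (pauli 1) ((V : Op1) * pauli 1 * (V : Op1)ᴴ)).re = b
  generalize (expect ρ (pauli 2) ((V : Op1) * pauli 2 * (V : Op1)ᴴ)).re = c
  have hin : ∀ θ : ℝ, ∫ φ in (0 : ℝ)..(2 * Real.pi), 1 / 2 * (1 + (Real.sin θ * Real.cos φ) ^ 2 * a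
        - (Real.sin θ * Real.sin φ) ^ 2 * b + Real.cos θ ^ 2 * c) * Real.sin θ =
      Real.pi * (1 + c) * Real.sin θ + Real.pi * ((a - b) / 2 - c) * Real.sin θ ^ 3 := by
    intro θ
    have h : ∀ φ : ℝ, 1 / 2 * (1 + (Real.sin θ * Real.cos φ) ^ 2 * a
        - (Real.sin θ * Real.sin φ) ^ 2 * b + Real.cos θ ^ 2 * c) * Real.sin θ =
        1 / 2 * Real.sin θ * (1 + Real.cos θ ^ 2 * c - Real.sin θ ^ 2 * b)
          + 1 / 2 * Real.sin θ ^ 3 * (a + b) * Real.cos φ ^ 2 := by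
      intro φ
      linear_combination (-1 / 2 * Real.sin θ ^ 3 * b) * Real.sin_sq_add_cos_sq φ
    simp only [h]
    rw [intervalIntegral.integral_add (Continuous.intervalIntegrable (by fun_prop) _ _)
      (Continuous.intervalIntegrable (by fun_prop) _ _),
      intervalIntegral.integral_const, intervalIntegral.integral_const_mul, integral_cos_sq]
    simp
    linear_combination (Real.pi * c * Real.sin θ) * Real.sin_sq_add_cos_sq θ
  simp only [hin]
  rw [intervalIntegral.integral_add (Continuous.intervalIntegrable (by fun_prop) _ _)
    (Continuous.intervalIntegrable (by fun_prop) _ _),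
    intervalIntegral.integral_const_mul, intervalIntegral.integral_const_mul, integral_sin,
    integral_sin_pow]
  simp
  field_simp
  ring

/-! ### Maximally entangled vectors as a real four-dimensional family -/

/-- The trace of a product of two real positive semidefinite matrices is nonnegative. -/
theorem trace_mul_nonneg_of_posSemidef {n : Type*} [Fintype n] [DecidableEq n] {A B : Matrix n n ℝ}
    (hA : A.PosSemidef) (hB : B.PosSemidef) : 0 ≤ (A * B).trace := by
  obtain ⟨C, rfl⟩ : ∃ C : Matrix n n ℝ, A = Cᴴ * C := by
    open scoped MatrixOrder in
    exact CStarAlgebra.nonneg_iff_eq_star_mul_self.mp hA.nonneg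
  rw [Matrix.mul_assoc, Matrix.trace_mul_comm]
  exact (hB.mul_mul_conjTranspose_same C).trace_nonneg

/-- A positive semidefinite matrix of trace one and purity above `1/2` takes a value above `1/2`
on some unit vector. -/
theorem exists_half_lt_dotProduct_mulVec {n : Type*} [Fintype n] [DecidableEq n]
    {A : Matrix n n ℝ} (hA : A.PosSemidef) (htr : A.trace = 1) (hsq : 1 / 2 < (A * A).trace) :
    ∃ x : n → ℝ, x ⬝ᵥ x = 1 ∧ 1 / 2 < x ⬝ᵥ A *ᵥ x := by
  by_contra! h
  -- By homogeneity the negated claim says `A ≤ 1/2`; then `Tr (A (1/2 - A)) ≥ 0` contradicts the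
  -- purity bound.
  have hB : ((1 / 2 : ℝ) • (1 : Matrix n n ℝ) - A).PosSemidef := by
    refine .of_dotProduct_mulVec_nonneg ?_ fun x => ?_
    · exact (Matrix.isHermitian_one.smul (k := (1 / 2 : ℝ)) (by rfl)).sub hA.1
    · have key : x ⬝ᵥ A *ᵥ x ≤ 1 / 2 * (x ⬝ᵥ x) := by
        by_cases hx : x ⬝ᵥ x = 0
        · rw [dotProduct_self_eq_zero.mp hx]; simp
        have hpos : 0 < x ⬝ᵥ x := lt_of_le_of_ne (by simpa using dotProduct_star_self_nonneg x)
          (Ne.symm hx)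
        have hs := Real.sq_sqrt hpos.le
        have hr : √(x ⬝ᵥ x) ≠ 0 := (Real.sqrt_pos.mpr hpos).ne'
        have := h ((√(x ⬝ᵥ x))⁻¹ • x) (by
          simp only [smul_dotProduct, dotProduct_smul, smul_eq_mul]
          field_simp
          exact hs.symm)
        simp only [Matrix.mulVec_smul, smul_dotProduct, dotProduct_smul, smul_eq_mul] at this
        rw [← mul_assoc, ← mul_inv, ← sq, hs, inv_mul_le_iff₀ hpos] at this
        linarith
      simp only [star_trivial, Matrix.sub_mulVec, Matrix.smul_mulVec, Matrix.one_mulVec,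
        dotProduct_sub, dotProduct_smul, smul_eq_mul]
      linarith
  have := trace_mul_nonneg_of_posSemidef hA hB
  simp [Matrix.mul_sub, htr] at this
  norm_num at hsq
  linarith

/-- The matrix `q 0 + i (q 1 s₁ + q 2 s₂ + q 3 s₃)`. -/
def quaternionMatrix (q : Fin 4 → ℝ) : Op1 :=
  !![q 0 + Complex.I * q 3, Complex.I * q 1 + q 2; Complex.I * q 1 - q 2, q 0 - Complex.I * q 3]

theorem quaternionMatrix_mem_unitaryGroup {q : Fin 4 → ℝ} (hq : q ⬝ᵥ q = 1) :
    quaternionMatrix q ∈ Matrix.unitaryGroup (Fin 2) ℂ := by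
  rw [Matrix.mem_unitaryGroup_iff, Matrix.star_eq_conjTranspose]
  simp only [dotProduct, Fin.sum_univ_four] at hq
  ext i j
  fin_cases i <;> fin_cases j <;>
    simp [quaternionMatrix, Matrix.mul_apply, Fin.sum_univ_two, Complex.ext_iff] <;>
    (try constructor) <;> first | linear_combination hq | ring

/-- The real symmetric matrix of the quadratic form `q ↦ ⟨ψ|ρ|ψ⟩` on the maximally entangled
vectors `ψ = (1 ⊗ V) Φ⁺`, `V = quaternionMatrix q`, in terms of the correlation matrix. -/
def entangledForm (t : Matrix (Fin 3) (Fin 3) ℝ) : Matrix (Fin 4) (Fin 4) ℝ :=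
  (1 / 4 : ℝ) • !![
    1 + t 0 0 - t 1 1 + t 2 2, t 1 2 + t 2 1, t 0 2 - t 2 0, -t 0 1 - t 1 0;
    t 1 2 + t 2 1, 1 + t 0 0 + t 1 1 - t 2 2, t 0 1 - t 1 0, t 0 2 + t 2 0;
    t 0 2 - t 2 0, t 0 1 - t 1 0, 1 - t 0 0 - t 1 1 - t 2 2, t 2 1 - t 1 2;
    -t 0 1 - t 1 0, t 0 2 + t 2 0, t 2 1 - t 1 2, 1 - t 0 0 + t 1 1 + t 2 2]

/-- Links the form to `avgFidelity_correction`; normalisation of `q` makes the constant term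
quadratic. -/
theorem fidelity_eq_entangledForm (ρ : Op2) {q : Fin 4 → ℝ} (hq : q ⬝ᵥ q = 1) :
    1 / 4 * (1 + (expect ρ (pauli 0) (quaternionMatrix q * pauli 0 * (quaternionMatrix q)ᴴ)).re
        - (expect ρ (pauli 1) (quaternionMatrix q * pauli 1 * (quaternionMatrix q)ᴴ)).re
        + (expect ρ (pauli 2) (quaternionMatrix q * pauli 2 * (quaternionMatrix q)ᴴ)).re) =
      q ⬝ᵥ entangledForm (correlationMatrix ρ) *ᵥ q := by
  simp only [dotProduct, Fin.sum_univ_four] at hq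
  simp only [entangledForm, correlationMatrix, expect, dotProduct, Matrix.mulVec,
    Fin.sum_univ_four, Matrix.trace, Matrix.diag, Matrix.mul_apply, Fintype.sum_prod_type,
    Fin.sum_univ_two, Matrix.kroneckerMap_apply, Matrix.conjTranspose_apply]
  simp [quaternionMatrix, pauli]
  linear_combination (-1/4) * hq

/-- The form is an expectation value of `ρ` for every `q`, so it inherits positivity from `ρ`. -/
theorem re_inner_eq_entangledForm (ρ : Op2) (hρ : ρ.trace = 1) (q : Fin 4 → ℝ) :
    1 / 2 * (star (fun p : Fin 2 × Fin 2 => quaternionMatrix q p.2 p.1) ⬝ᵥ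
      ρ *ᵥ (fun p : Fin 2 × Fin 2 => quaternionMatrix q p.2 p.1)).re =
      q ⬝ᵥ entangledForm (correlationMatrix ρ) *ᵥ q := by
  have h := congrArg Complex.re hρ
  simp [Matrix.trace, Fintype.sum_prod_type, Fin.sum_univ_two] at h
  simp only [entangledForm, correlationMatrix, expect, dotProduct, Matrix.mulVec,
    Fin.sum_univ_four, Matrix.trace, Matrix.diag, Matrix.mul_apply, Fintype.sum_prod_type,
    Fin.sum_univ_two, Matrix.kroneckerMap_apply]
  simp [quaternionMatrix, pauli]
  linear_combination (1/4) * (q 0 ^ 2 + q 1 ^ 2 + q 2 ^ 2 + q 3 ^ 2) * h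

theorem posSemidef_entangledForm {ρ : Op2} (hρ : IsDensityMatrix ρ) :
    (entangledForm (correlationMatrix ρ)).PosSemidef := by
  refine .of_dotProduct_mulVec_nonneg ?_ fun q => ?_
  · ext i j
    fin_cases i <;> fin_cases j <;> simp [entangledForm]
  · rw [star_trivial, ← re_inner_eq_entangledForm ρ hρ.2]
    have := (Complex.nonneg_iff.mp (hρ.1.dotProduct_mulVec_nonneg
      (fun p : Fin 2 × Fin 2 => quaternionMatrix q p.2 p.1))).1
    positivity

theorem trace_entangledForm (t : Matrix (Fin 3) (Fin 3) ℝ) : (entangledForm t).trace = 1 := by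
  simp [entangledForm, Matrix.trace, Fin.sum_univ_four]
  ring

/-- The traceless part of the form depends on `t` by a scaled isometry. -/
theorem trace_entangledForm_sq (t : Matrix (Fin 3) (Fin 3) ℝ) :
    (entangledForm t * entangledForm t).trace = 1 / 4 * (1 + (tᵀ * t).trace) := by
  simp [entangledForm, Matrix.trace, Fin.sum_univ_four, Fin.sum_univ_three, Matrix.mul_apply]
  ring

/-! ### The optimal steering parameter -/

theorem isHermitian_pauli (i : Fin 3) : (pauli i).IsHermitian := by
  ext a b
  fin_cases i <;> fin_cases a <;> fin_cases b <;> simp [pauli]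

theorem expect_pauli {ρ : Op2} (hρ : ρ.IsHermitian) (i j : Fin 3) :
    expect ρ (pauli i) (pauli j) = correlationMatrix ρ i j := by
  refine (Complex.conj_eq_iff_re.mp ?_).symm
  rw [← Complex.star_def, expect, ← Matrix.trace_conjTranspose, Matrix.conjTranspose_mul,
    Matrix.conjTranspose_kronecker, hρ.eq, (isHermitian_pauli i).eq, (isHermitian_pauli j).eq,
    Matrix.trace_mul_comm]

theorem expect_spin {ρ : Op2} (hρ : ρ.IsHermitian) (u v : EuclideanSpace ℝ (Fin 3)) :
    expect ρ (spin u) (spin v) =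
      (inner ℝ u (Matrix.toEuclideanLin (correlationMatrix ρ) v) : ℝ) := by
  have h : expect ρ (spin u) (spin v) =
      ∑ i, ∑ j, (u i : ℂ) * (v j : ℂ) * expect ρ (pauli i) (pauli j) := by
    simp only [expect, spin, Fin.sum_univ_three, Matrix.add_kronecker, Matrix.kronecker_add,
      Matrix.smul_kronecker, Matrix.kronecker_smul, Matrix.mul_add, Matrix.mul_smul,
      Matrix.trace_add, Matrix.trace_smul, smul_eq_mul]
    ring
  rw [h]
  simp only [expect_pauli hρ]
  norm_cast
  simp only [PiLp.inner_apply, Matrix.ofLp_toLpLin, Matrix.toLin'_apply, Matrix.mulVec, dotProduct,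
    RCLike.inner_apply, conj_trivial, Finset.sum_mul]
  exact Finset.sum_congr rfl fun i _ => Finset.sum_congr rfl fun j _ => by ring

theorem steeringParameter_eq {ρ : Op2} (hρ : ρ.IsHermitian) (μ : MeasurementDirections) :
    steeringParameter ρ μ = 1 / √3 *
      |∑ i, inner ℝ (μ.u i) (Matrix.toEuclideanLin (correlationMatrix ρ) (μ.v i))| := by
  simp only [steeringParameter, expect_spin hρ]
  rw [← Complex.ofReal_sum, Complex.norm_real, Real.norm_eq_abs]

theorem sum_corrEigenvalues (ρ : Op2) :
    ∑ i, corrEigenvalues ρ i = ((correlationMatrix ρ)ᵀ * correlationMatrix ρ).trace := by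
  have := (Matrix.isHermitian_conjTranspose_mul_self (correlationMatrix ρ)).trace_eq_sum_eigenvalues
  simpa [corrEigenvalues] using this.symm

theorem corrEigenvalues_nonneg (ρ : Op2) (i : Fin 3) : 0 ≤ corrEigenvalues ρ i :=
  (Matrix.posSemidef_conjTranspose_mul_self (correlationMatrix ρ)).eigenvalues_nonneg i

/-- The squared norms of the images of an orthonormal basis add up to the squared
Hilbert–Schmidt norm. -/
theorem sum_norm_sq_toEuclideanLin {n : Type*} [Fintype n] [DecidableEq n] (T : Matrix n n ℝ)
    (b : OrthonormalBasis n ℝ (EuclideanSpace ℝ n)) :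
    ∑ i, ‖Matrix.toEuclideanLin T (b i)‖ ^ 2 = (Tᵀ * T).trace := by
  have h := LinearMap.trace_eq_sum_inner (Matrix.toEuclideanLin (Tᵀ * T)) b
  have h1 : LinearMap.trace ℝ _ (Matrix.toEuclideanLin (Tᵀ * T)) = (Tᵀ * T).trace := by
    rw [Matrix.toEuclideanLin_eq_toLin_orthonormal, Matrix.trace_toLin_eq]
  rw [← h1, h]
  refine Finset.sum_congr rfl fun i _ => ?_
  rw [← real_inner_self_eq_norm_sq, ← LinearMap.adjoint_inner_right,
    ← Matrix.toEuclideanLin_conjTranspose_eq_adjoint]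
  simp [Matrix.toLpLin_apply, Matrix.mulVec_mulVec]

/-- Along `(cos t, sin t)` the expression changes from `a` at `0` to `-a` at `π / 2`. -/
theorem exists_sq_add_sq_eq_one_and (a b : ℝ) :
    ∃ c s : ℝ, c ^ 2 + s ^ 2 = 1 ∧ (c ^ 2 - s ^ 2) * a + 2 * c * s * b = 0 := by
  have hf : Continuous fun t : ℝ => (Real.cos t ^ 2 - Real.sin t ^ 2) * a
      + 2 * Real.cos t * Real.sin t * b := by fun_prop
  have h0 := mem_range_of_exists_le_of_exists_ge hf (c := 0)
  have : (0 : ℝ) ∈ Set.range fun t : ℝ => (Real.cos t ^ 2 - Real.sin t ^ 2) * a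
      + 2 * Real.cos t * Real.sin t * b := by
    rcases le_total a 0 with ha | ha
    · exact h0 ⟨0, by simpa using ha⟩ ⟨Real.pi / 2, by simpa using ha⟩
    · exact h0 ⟨Real.pi / 2, by simpa using ha⟩ ⟨0, by simpa using ha⟩
  obtain ⟨t, ht⟩ := this
  exact ⟨Real.cos t, Real.sin t, Real.cos_sq_add_sin_sq t, ht⟩

/-- For any three weights there is an orthogonal matrix whose squared entries average the weights
equally in each row. -/
theorem exists_orthogonal_averaging (l : Fin 3 → ℝ) :
    ∃ O : Matrix (Fin 3) (Fin 3) ℝ, O * Oᵀ = 1 ∧ ∀ i, ∑ j, O i j ^ 2 * l j = (∑ j, l j) / 3 := by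
  obtain ⟨α, hα⟩ : ∃ α : ℝ, α ^ 2 = 1 / 3 := ⟨√(1 / 3), Real.sq_sqrt (by norm_num)⟩
  obtain ⟨β, hβ⟩ : ∃ β : ℝ, β ^ 2 = 1 / 2 := ⟨√(1 / 2), Real.sq_sqrt (by norm_num)⟩
  -- The first row is `(1, 1, 1) / √3` up to sign; the others rotate `(1, -1, 0) / √2` and `(1, 1,
  -- -2) / √6`. The angle makes the form `diag l` agree on these two rows, and the trace fixes the
  -- common value.
  obtain ⟨c, s, hcs, h⟩ := exists_sq_add_sq_eq_one_and ((l 0 + l 1 - 2 * l 2) / 3)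
    (α * (l 0 - l 1))
  refine ⟨!![α, α, α;
    c * β + s * (α * β), -c * β + s * (α * β), -2 * s * (α * β);
    -s * β + c * (α * β), s * β + c * (α * β), -2 * c * (α * β)], ?_, fun i => ?_⟩
  · ext i j
    fin_cases i <;> fin_cases j <;> simp [Matrix.mul_apply, Fin.sum_univ_three]
    · linear_combination 3 * hα
    · ring
    · ring
    · ring
    · linear_combination 2 * hβ + 6 * s ^ 2 * β ^ 2 * hα + (2 * c ^ 2 + 2 * s ^ 2 - 2) * hβ + hcs
    · linear_combination 6 * c * s * β ^ 2 * hα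
    · ring
    · linear_combination 6 * c * s * β ^ 2 * hα
    · linear_combination 2 * hβ + 6 * c ^ 2 * β ^ 2 * hα + (2 * c ^ 2 + 2 * s ^ 2 - 2) * hβ + hcs
  · fin_cases i <;> simp [Fin.sum_univ_three]
    · linear_combination (l 0 + l 1 + l 2) * hα
    · linear_combination (c ^ 2 * (l 0 + l 1) + 2 * c * s * α * (l 0 - l 1)
        + s ^ 2 * α ^ 2 * (l 0 + l 1 + 4 * l 2)) * hβ
        + 1 / 2 * s ^ 2 * (l 0 + l 1 + 4 * l 2) * hα + 1 / 2 * h + (l 0 + l 1 + l 2) / 3 * hcs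
    · linear_combination (s ^ 2 * (l 0 + l 1) - 2 * c * s * α * (l 0 - l 1)
        + c ^ 2 * α ^ 2 * (l 0 + l 1 + 4 * l 2)) * hβ
        + 1 / 2 * c ^ 2 * (l 0 + l 1 + 4 * l 2) * hα - 1 / 2 * h + (l 0 + l 1 + l 2) / 3 * hcs

/-- A `3 × 3` matrix stretches the vectors of some orthonormal system by equal factors. -/
theorem exists_orthonormal_norm_sq_eq (T : Matrix (Fin 3) (Fin 3) ℝ) :
    ∃ v : Fin 3 → EuclideanSpace ℝ (Fin 3), Orthonormal ℝ v ∧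
      ∀ i, ‖Matrix.toEuclideanLin T (v i)‖ ^ 2 = (Tᵀ * T).trace / 3 := by
  have hT := Matrix.isHermitian_conjTranspose_mul_self T
  obtain ⟨O, hO, hl⟩ := exists_orthogonal_averaging hT.eigenvalues
  set w := hT.eigenvectorBasis with hw
  -- `T` keeps the eigenbasis of `TᵀT` orthogonal, so squared stretches of combinations are weighted
  -- averages of eigenvalues.
  have hTw : ∀ i j, inner ℝ (Matrix.toEuclideanLin T (w i)) (Matrix.toEuclideanLin T (w j)) =
      if i = j then hT.eigenvalues j else 0 := by
    intro i j
    have hj : Matrix.toEuclideanLin (Tᴴ * T) (w j) = hT.eigenvalues j • w j := by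
      apply WithLp.ofLp_injective
      simpa [Matrix.toLpLin_apply, hw] using hT.mulVec_eigenvectorBasis j
    have : Matrix.toEuclideanLin Tᴴ (Matrix.toEuclideanLin T (w j)) =
        Matrix.toEuclideanLin (Tᴴ * T) (w j) := by
      simp [Matrix.toLpLin_apply, Matrix.mulVec_mulVec]
    rw [← LinearMap.adjoint_inner_right, ← Matrix.toEuclideanLin_conjTranspose_eq_adjoint, this,
      hj, inner_smul_right, orthonormal_iff_ite.mp w.orthonormal]
    simp
  have htr : ∑ j, hT.eigenvalues j = (Tᵀ * T).trace := by
    simpa using hT.trace_eq_sum_eigenvalues.symm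
  refine ⟨fun i => ∑ j, O i j • w j, orthonormal_iff_ite.mpr fun i j => ?_, fun i => ?_⟩
  · have := congrFun (congrFun hO i) j
    simpa [sum_inner, inner_sum, inner_smul_left, inner_smul_right,
      orthonormal_iff_ite.mp w.orthonormal, Matrix.mul_apply, Matrix.one_apply, mul_comm] using this
  · rw [← htr, ← hl i, ← real_inner_self_eq_norm_sq]
    simp only [map_sum, map_smul, sum_inner, inner_sum, inner_smul_left, inner_smul_right, hTw]
    simp
    exact Finset.sum_congr rfl fun j _ => by ring

theorem steeringParameter_le {ρ : Op2} (hρ : ρ.IsHermitian) (μ : MeasurementDirections) :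
    steeringParameter ρ μ ≤ √(∑ i, corrEigenvalues ρ i) := by
  set T := correlationMatrix ρ with hT
  have hspan : ⊤ ≤ Submodule.span ℝ (Set.range μ.v) :=
    (μ.orthonormal_v.linearIndependent.span_eq_top_of_card_eq_finrank' (by simp)).ge
  have hsum := sum_norm_sq_toEuclideanLin T (OrthonormalBasis.mk μ.orthonormal_v hspan)
  simp only [OrthonormalBasis.coe_mk] at hsum
  have h1 : |∑ i, inner ℝ (μ.u i) (Matrix.toEuclideanLin T (μ.v i))| ≤
      ∑ i, ‖Matrix.toEuclideanLin T (μ.v i)‖ := by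
    refine (Finset.abs_sum_le_sum_abs _ _).trans (Finset.sum_le_sum fun i _ => ?_)
    simpa [μ.norm_u i] using abs_real_inner_le_norm (μ.u i) (Matrix.toEuclideanLin T (μ.v i))
  have h2 : (∑ i, ‖Matrix.toEuclideanLin T (μ.v i)‖) ^ 2 ≤ 3 * (Tᵀ * T).trace := by
    have := sq_sum_le_card_mul_sum_sq (s := Finset.univ)
      (f := fun i => ‖Matrix.toEuclideanLin T (μ.v i)‖)
    rw [hsum] at this
    simpa using this
  rw [steeringParameter_eq hρ, sum_corrEigenvalues, one_div, inv_mul_le_iff₀ (by positivity),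
    ← Real.sqrt_mul (by norm_num)]
  exact h1.trans (Real.le_sqrt_of_sq_le h2)

theorem exists_steeringParameter_eq {ρ : Op2} (hρ : ρ.IsHermitian) :
    ∃ μ, steeringParameter ρ μ = √(∑ i, corrEigenvalues ρ i) := by
  set T := correlationMatrix ρ with hT
  obtain ⟨v, hv, hTv⟩ := exists_orthonormal_norm_sq_eq T
  have hu : ∀ x : EuclideanSpace ℝ (Fin 3),
      ∃ u : EuclideanSpace ℝ (Fin 3), ‖u‖ = 1 ∧ inner ℝ u x = ‖x‖ := by
    intro x
    by_cases hx : x = 0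
    -- Any unit vector serves when `x = 0`.
    · exact ⟨v 0, hv.1 0, by simp [hx]⟩
    · have hn := norm_ne_zero_iff.mpr hx
      refine ⟨‖x‖⁻¹ • x, norm_smul_inv_norm hx, ?_⟩
      rw [real_inner_smul_left, real_inner_self_eq_norm_sq]
      field_simp
  choose u hu1 hu2 using hu
  refine ⟨⟨fun i => u (Matrix.toEuclideanLin T (v i)), v, fun i => hu1 _, hv⟩, ?_⟩
  have hn : ∀ i, ‖Matrix.toEuclideanLin T (v i)‖ = √((Tᵀ * T).trace) / √3 := by
    intro i
    rw [← Real.sqrt_div' _ (by norm_num), ← hTv i, Real.sqrt_sq (norm_nonneg _)]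
  rw [steeringParameter_eq hρ, sum_corrEigenvalues]
  simp only [← hT, hu2, hn, Finset.sum_const, Finset.card_univ, Fintype.card_fin, nsmul_eq_mul]
  rw [abs_of_nonneg (by positivity)]
  have h3 : √(3 : ℝ) ^ 2 = 3 := Real.sq_sqrt (by norm_num)
  field_simp
  rw [h3]
  norm_num

theorem isGreatest_steeringParameter {ρ : Op2} (hρ : ρ.IsHermitian) :
    IsGreatest (Set.range (steeringParameter ρ)) (√(∑ i, corrEigenvalues ρ i)) :=
  ⟨exists_steeringParameter_eq hρ, Set.forall_mem_range.mpr (steeringParameter_le hρ)⟩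

/-! ### Comparison with `N`, and usefulness for teleportation -/

theorem sqrt_sum_corrEigenvalues_le_N (ρ : Op2) : √(∑ i, corrEigenvalues ρ i) ≤ N ρ := by
  refine Real.sqrt_le_iff.mpr ⟨Finset.sum_nonneg fun i _ => Real.sqrt_nonneg _, ?_⟩
  calc ∑ i, corrEigenvalues ρ i = ∑ i, √(corrEigenvalues ρ i) ^ 2 :=
        Finset.sum_congr rfl fun i _ => (Real.sq_sqrt (corrEigenvalues_nonneg ρ i)).symm
    _ ≤ N ρ ^ 2 := Finset.sum_sq_le_sq_sum_of_nonneg fun i _ => Real.sqrt_nonneg _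

theorem isUsefulForTeleportation_of_one_lt_sum {ρ : Op2} (hρ : IsDensityMatrix ρ)
    (h : 1 < ∑ i, corrEigenvalues ρ i) : IsUsefulForTeleportation ρ := by
  obtain ⟨q, hq, hlt⟩ := exists_half_lt_dotProduct_mulVec (posSemidef_entangledForm hρ)
    (trace_entangledForm _) (by
      rw [trace_entangledForm_sq, ← sum_corrEigenvalues]
      linarith)
  rw [← fidelity_eq_entangledForm ρ hq] at hlt
  refine ⟨correction ⟨quaternionMatrix q, quaternionMatrix_mem_unitaryGroup hq⟩, ?_⟩
  rw [avgFidelity_correction ρ hρ.2]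
  linarith

end TwoQubit

end

theorem mainTheorem6 (ζ : TwoQubit.Op2) (hζ : TwoQubit.IsDensityMatrix ζ) :
    IsGreatest (Set.range (TwoQubit.steeringParameter ζ)) (TwoQubit.F3 ζ) ∧
    TwoQubit.F3 ζ = √(∑ i, TwoQubit.corrEigenvalues ζ i) ∧
    TwoQubit.F3 ζ ≤ TwoQubit.N ζ ∧
    (TwoQubit.IsThreeSteerable ζ → TwoQubit.IsUsefulForTeleportation ζ) := by
  have hmax := TwoQubit.isGreatest_steeringParameter hζ.1.1
  have hF : TwoQubit.F3 ζ = √(∑ i, TwoQubit.corrEigenvalues ζ i) := hmax.csSup_eq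
  refine ⟨hF ▸ hmax, hF, hF ▸ TwoQubit.sqrt_sum_corrEigenvalues_le_N ζ, fun h => ?_⟩
  refine TwoQubit.isUsefulForTeleportation_of_one_lt_sum hζ ?_
  rw [TwoQubit.IsThreeSteerable, hF, Real.lt_sqrt zero_le_one, one_pow] at h
  exact h
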